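/- Let $d,n\ge 1$ be integers and let $d\mu(x)=(2\pi)^{-d/2}e^{-|x|^2/2}\,dx$ be the standard Gaussian measure on $\mathbb R^d$. For $k=(k_1,\dots,k_d)\in\mathbb N^d$ write $|k|=\sum_j k_j$ and let $H_k(x)=\prod_{j=1}^d h_{k_j}(x_j)$ be the normalized tensor Hermite polynomials, where $h_m(y)=(-1)^m (m!)^{-1/2}e^{y^2/2}\frac{d^m}{dy^m}\big(e^{-y^2/2}\big)$. Let $w\in L^2(\mathbb R^d,d\mu)$ be real-valued with $\int w\,d\mu=1$ and $\int w\,H_k\,d\mu=0$ for all $k\in\mathbb N^d$ with $0<|k|<n$. Then $$\|w-1\|_{L^2(d\mu)}^2\le \frac1n\,\|\nabla w\|_{L^2(d\mu)}^2,$$ where $\nabla w$ is the weak gradient and the right-hand side is understood as $+\infty$ if $w$ has no weak gradient in $L^2(d\mu)$. The constant $1/n$ is optimal: it is the smallest constant $C\ge 0$ such that $\|w-1\|_{L^2(d\mu)}^2\le C\,\|\nabla w\|_{L^2(d\mu)}^2$ for all such $w$. -/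

import Mathlib

open MeasureTheory
open scoped ENNReal NNReal ContDiff

noncomputable section

/-- The Gaussian measure `dμ = (2π)^(-d/2) exp(-|x|²/2) dx` on `ℝ^d`. -/
def gaussianMeasure (d : ℕ) : Measure (EuclideanSpace ℝ (Fin d)) :=
  volume.withDensity fun x =>
    ENNReal.ofReal ((2 * Real.pi) ^ (-(d : ℝ) / 2) * Real.exp (-‖x‖ ^ 2 / 2))

/-- The normalized Hermite polynomial
`h_m(y) = (-1)^m (m!)^(-1/2) exp(y²/2) (d/dy)^m exp(-y²/2)`. -/
def hermiteFun (m : ℕ) (y : ℝ) : ℝ :=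
  (-1) ^ m * (Real.sqrt (m.factorial : ℝ))⁻¹ * Real.exp (y ^ 2 / 2) *
    iteratedDeriv m (fun z : ℝ => Real.exp (-z ^ 2 / 2)) y

/-- The tensor Hermite polynomial `H_k(x) = ∏ j, h_{k_j}(x_j)`. -/
def hermiteTensor {d : ℕ} (k : Fin d → ℕ) (x : EuclideanSpace ℝ (Fin d)) : ℝ :=
  ∏ j, hermiteFun (k j) (x j)

/-- `g` is the weak (distributional) gradient of `w` on `ℝ^d`: both are locally integrable for
Lebesgue measure, and `∫ w ∂ᵢφ dx = -∫ gᵢ φ dx` for all test functions `φ ∈ C_c^∞(ℝ^d)`. -/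
structure HasWeakGradient {d : ℕ} (w : EuclideanSpace ℝ (Fin d) → ℝ)
    (g : EuclideanSpace ℝ (Fin d) → EuclideanSpace ℝ (Fin d)) : Prop where
  locallyIntegrable : LocallyIntegrable w volume
  locallyIntegrable_grad : LocallyIntegrable g volume
  integral_eq : ∀ φ : EuclideanSpace ℝ (Fin d) → ℝ, ContDiff ℝ ∞ φ → HasCompactSupport φ →
    ∀ i : Fin d, ∫ x, w x * fderiv ℝ φ x (EuclideanSpace.single i 1) = -∫ x, g x i * φ x

end

/-! The inequality is a spectral gap read off from Hermite coefficients. Write `c_k = ∫ w H_k dμ`.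
The functions `H_k` form a Hilbert basis of `L²(μ)`, so `‖w - 1‖² = ∑_{k ≠ 0} c_k²`
(`eLpNorm_sq_eq_tsum_hermite`). Gaussian integration by parts turns `∂ᵢ` into a weighted shift, `∫
gᵢ H_k dμ = √(kᵢ + 1) c_{k + eᵢ}` (`HasWeakGradient.integral_grad_mul_hermiteTensor`). Parseval for
each `gᵢ` then gives `‖g‖² = ∑ |k| c_k²` (`HasWeakGradient.eLpNorm_grad_sq_eq_tsum`). Since `c_k =
0` for `0 < |k| < n`, the two series compare term by term with factor `n`. Equality holds for `w = 1
+ H_k` with `|k| = n`, hence optimality.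

Orthonormality comes from the same integration by parts. Completeness comes from uniqueness of
characteristic functions, because the Gaussian weight lets `exp(i⟨x, ξ⟩)` be integrated as a power
series against `L²` functions. -/

/-! ### Hermite polynomials in one variable. -/

theorem Polynomial.derivative_hermite_succ (n : ℕ) :
    derivative (hermite (n + 1)) = ((n : Polynomial ℤ) + 1) * hermite n := by
  induction n with
  | zero => simp
  | succ n ih =>
    rw [hermite_succ (n + 1), derivative_sub, derivative_mul, derivative_X, ih, derivative_mul]
    have h : derivative ((n : Polynomial ℤ) + 1) = 0 := by simp
    rw [h, hermite_succ n]
    push_cast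
    ring

theorem hermiteFun_eq_aeval (m : ℕ) (y : ℝ) :
    hermiteFun m y = (√(m.factorial : ℝ))⁻¹ * Polynomial.aeval y (Polynomial.hermite m) := by
  rw [Polynomial.hermite_eq_deriv_gaussian', hermiteFun, iteratedDeriv_eq_iterate]
  simp only [neg_div]
  ring

theorem contDiff_hermiteFun (m : ℕ) : ContDiff ℝ ∞ (hermiteFun m) := by
  rw [funext (hermiteFun_eq_aeval m)]
  exact contDiff_const.mul (Polynomial.contDiff_aeval _ _)

theorem hermiteFun_zero (y : ℝ) : hermiteFun 0 y = 1 := by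
  simp [hermiteFun_eq_aeval]

/-- Lowering operator. At `m = 0` the truncated index `m - 1` is harmless, because its factor `√0`
vanishes. -/
theorem hasDerivAt_hermiteFun (m : ℕ) (y : ℝ) :
    HasDerivAt (hermiteFun m) (√(m : ℝ) * hermiteFun (m - 1) y) y := by
  cases m with
  | zero =>
    rw [funext hermiteFun_zero]
    simpa using hasDerivAt_const y (1 : ℝ)
  | succ m =>
    rw [funext (hermiteFun_eq_aeval (m + 1))]
    refine (((Polynomial.hermite (m + 1)).hasDerivAt_aeval y).const_mul
      (√((m + 1).factorial : ℝ))⁻¹).congr_deriv ?_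
    rw [Polynomial.derivative_hermite_succ, hermiteFun_eq_aeval, Nat.factorial_succ]
    have h1 : (0 : ℝ) < m + 1 := by positivity
    have h2 : (0 : ℝ) < m.factorial := by positivity
    have h3 := Real.mul_self_sqrt h1.le
    have h4 := (Real.sqrt_pos.2 h1).ne'
    have h5 := (Real.sqrt_pos.2 h2).ne'
    simp only [Nat.add_sub_cancel, map_mul, map_add, map_natCast, map_one]
    push_cast
    rw [Real.sqrt_mul h1.le]
    field_simp
    rw [sq, h3]

/-- Raising operator `y - d/dy`, the adjoint of the derivative for the Gaussian weight. -/
theorem sqrt_mul_hermiteFun_succ (m : ℕ) (y : ℝ) :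
    √((m : ℝ) + 1) * hermiteFun (m + 1) y =
      y * hermiteFun m y - √(m : ℝ) * hermiteFun (m - 1) y := by
  have h := hasDerivAt_hermiteFun m y
  rw [funext (hermiteFun_eq_aeval m)] at h
  have h' := ((Polynomial.hermite m).hasDerivAt_aeval y).const_mul (√(m.factorial : ℝ))⁻¹
  rw [h.unique h', hermiteFun_eq_aeval, hermiteFun_eq_aeval, Polynomial.hermite_succ,
    Nat.factorial_succ]
  have h1 : (0 : ℝ) < m + 1 := by positivity
  have h2 : (0 : ℝ) < m.factorial := by positivity
  have h4 := (Real.sqrt_pos.2 h1).ne'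
  have h5 := (Real.sqrt_pos.2 h2).ne'
  push_cast
  rw [Real.sqrt_mul h1.le]
  simp only [map_sub, map_mul, Polynomial.aeval_X]
  field_simp

/-! ### Raising and lowering for tensor Hermite polynomials. -/

section Tensor

variable {d : ℕ}

theorem hermiteTensor_update (k : Fin d → ℕ) (i : Fin d) (m : ℕ) (x : EuclideanSpace ℝ (Fin d)) :
    hermiteTensor (Function.update k i m) x =
      hermiteFun m (x i) * ∏ j ∈ Finset.univ.erase i, hermiteFun (k j) (x j) := by
  rw [hermiteTensor, ← Finset.mul_prod_erase _ _ (Finset.mem_univ i), Function.update_self]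
  congr 1
  refine Finset.prod_congr rfl fun j hj => ?_
  rw [Function.update_of_ne (Finset.ne_of_mem_erase hj)]

theorem hermiteTensor_eq_mul_prod_erase (k : Fin d → ℕ) (i : Fin d)
    (x : EuclideanSpace ℝ (Fin d)) :
    hermiteTensor k x =
      hermiteFun (k i) (x i) * ∏ j ∈ Finset.univ.erase i, hermiteFun (k j) (x j) := by
  rw [← hermiteTensor_update, Function.update_eq_self]

theorem hermiteTensor_zero (x : EuclideanSpace ℝ (Fin d)) :
    hermiteTensor (0 : Fin d → ℕ) x = 1 := by
  simp [hermiteTensor, hermiteFun_zero]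

theorem contDiff_hermiteTensor (k : Fin d → ℕ) : ContDiff ℝ ∞ (hermiteTensor k) := by
  unfold hermiteTensor
  refine contDiff_prod fun j _ => (contDiff_hermiteFun (k j)).comp ?_
  exact (EuclideanSpace.proj (𝕜 := ℝ) j).contDiff

theorem fderiv_hermiteTensor_single (k : Fin d → ℕ) (i : Fin d) (x : EuclideanSpace ℝ (Fin d)) :
    fderiv ℝ (hermiteTensor k) x (EuclideanSpace.single i 1) =
      √(k i : ℝ) * hermiteTensor (Function.update k i (k i - 1)) x := by
  have hd : DifferentiableAt ℝ (hermiteTensor k) x :=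
    (contDiff_hermiteTensor k).differentiable (by simp) x
  rw [← hd.lineDeriv_eq_fderiv]
  refine HasLineDerivAt.lineDeriv ?_
  rw [HasLineDerivAt, hermiteTensor_update, ← mul_assoc]
  have h : (fun t : ℝ => hermiteTensor k (x + t • EuclideanSpace.single i 1)) = fun t =>
      hermiteFun (k i) (x i + t) * ∏ j ∈ Finset.univ.erase i, hermiteFun (k j) (x j) := by
    funext t
    rw [hermiteTensor_eq_mul_prod_erase k i]
    congr 1
    · simp
    · refine Finset.prod_congr rfl fun j hj => ?_
      simp [Finset.ne_of_mem_erase hj]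
  rw [h]
  refine HasDerivAt.mul_const ?_ _
  refine HasDerivAt.comp_const_add (x i) 0 ?_
  simpa using hasDerivAt_hermiteFun (k i) (x i)

theorem sqrt_mul_hermiteTensor_update_succ (k : Fin d → ℕ) (i : Fin d)
    (x : EuclideanSpace ℝ (Fin d)) :
    √((k i : ℝ) + 1) * hermiteTensor (Function.update k i (k i + 1)) x =
      x i * hermiteTensor k x - √(k i : ℝ) * hermiteTensor (Function.update k i (k i - 1)) x := by
  rw [hermiteTensor_update, hermiteTensor_update, hermiteTensor_eq_mul_prod_erase k i,
    ← mul_assoc, sqrt_mul_hermiteFun_succ]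
  ring

end Tensor

/-! ### Functions of at most exponential growth. -/

/-- `f` grows at most exponentially: `|f x| ≤ C exp (a ‖x‖)` for some `C, a ≥ 0`. -/
def ExpBounded {E : Type*} [NormedAddCommGroup E] (f : E → ℝ) : Prop :=
  ∃ C a : ℝ, 0 ≤ C ∧ 0 ≤ a ∧ ∀ x, |f x| ≤ C * Real.exp (a * ‖x‖)

namespace ExpBounded

variable {E : Type*} [NormedAddCommGroup E] {f g : E → ℝ}

theorem mul (hf : ExpBounded f) (hg : ExpBounded g) : ExpBounded fun x => f x * g x := by
  obtain ⟨C, a, hC, ha, h⟩ := hf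
  obtain ⟨D, b, hD, hb, h'⟩ := hg
  refine ⟨C * D, a + b, by positivity, by positivity, fun x => ?_⟩
  rw [abs_mul, add_mul, Real.exp_add]
  calc |f x| * |g x| ≤ (C * Real.exp (a * ‖x‖)) * (D * Real.exp (b * ‖x‖)) :=
        mul_le_mul (h x) (h' x) (abs_nonneg _) (by positivity)
    _ = _ := by ring

theorem add (hf : ExpBounded f) (hg : ExpBounded g) : ExpBounded fun x => f x + g x := by
  obtain ⟨C, a, hC, ha, h⟩ := hf
  obtain ⟨D, b, hD, hb, h'⟩ := hg
  refine ⟨C + D, a + b, by positivity, by positivity, fun x => ?_⟩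
  have h1 : Real.exp (a * ‖x‖) ≤ Real.exp ((a + b) * ‖x‖) := by gcongr; linarith
  have h2 : Real.exp (b * ‖x‖) ≤ Real.exp ((a + b) * ‖x‖) := by gcongr; linarith
  calc |f x + g x| ≤ |f x| + |g x| := abs_add_le _ _
    _ ≤ C * Real.exp (a * ‖x‖) + D * Real.exp (b * ‖x‖) := add_le_add (h x) (h' x)
    _ ≤ C * Real.exp ((a + b) * ‖x‖) + D * Real.exp ((a + b) * ‖x‖) := by gcongr
    _ = _ := by ring

theorem const (c : ℝ) : ExpBounded fun _ : E => c :=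
  ⟨|c|, 0, abs_nonneg _, le_rfl, fun x => by simp⟩

theorem of_le_norm (h : ∀ x, |f x| ≤ ‖x‖) : ExpBounded f :=
  ⟨1, 1, zero_le_one, zero_le_one, fun x => (h x).trans <| by
    linarith [Real.add_one_le_exp ‖x‖, one_mul ‖x‖, one_mul (Real.exp (1 * ‖x‖)),
      congrArg Real.exp (one_mul ‖x‖)]⟩

theorem finset_prod {ι : Type*} (s : Finset ι) {F : ι → E → ℝ} (h : ∀ i ∈ s, ExpBounded (F i)) :
    ExpBounded fun x => ∏ i ∈ s, F i x := by
  classical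
  induction s using Finset.induction_on with
  | empty => simpa using const (E := E) 1
  | insert i s hi ih =>
    simp only [Finset.prod_insert hi]
    exact (h i (by simp)).mul (ih fun j hj => h j (by simp [hj]))

theorem pow (hf : ExpBounded f) (n : ℕ) : ExpBounded fun x => f x ^ n := by
  simpa using finset_prod (Finset.range n) (F := fun _ => f) fun _ _ => hf

theorem comp_of_norm_le {E' : Type*} [NormedAddCommGroup E'] {u : E' → E} (hf : ExpBounded f)
    (hu : ∀ x, ‖u x‖ ≤ ‖x‖) : ExpBounded fun x => f (u x) := by
  obtain ⟨C, a, hC, ha, h⟩ := hf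
  refine ⟨C, a, hC, ha, fun x => (h (u x)).trans ?_⟩
  gcongr
  exact hu x

theorem aeval (p : Polynomial ℤ) : ExpBounded fun y : ℝ => Polynomial.aeval y p := by
  induction p using Polynomial.induction_on' with
  | add p q hp hq => simpa using hp.add hq
  | monomial n a =>
    simpa [Polynomial.aeval_monomial] using
      (const (E := ℝ) (a : ℝ)).mul ((of_le_norm (f := fun y : ℝ => y) fun x => le_rfl).pow n)

theorem hermiteFun (m : ℕ) : ExpBounded (hermiteFun m) := by
  rw [funext (hermiteFun_eq_aeval m)]
  exact (const _).mul (aeval _)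

theorem hermiteTensor {d : ℕ} (k : Fin d → ℕ) : ExpBounded (hermiteTensor k) :=
  finset_prod _ fun i _ => (hermiteFun (k i)).comp_of_norm_le fun x => PiLp.norm_apply_le x i

end ExpBounded

/-! ### Density, total mass and integrability for the Gaussian measure. -/

section GaussianMeasure

variable {d : ℕ}

/-- The density of `gaussianMeasure d` with respect to Lebesgue measure. -/
noncomputable def gaussianDensity (d : ℕ) (x : EuclideanSpace ℝ (Fin d)) : ℝ :=
  (2 * Real.pi) ^ (-(d : ℝ) / 2) * Real.exp (-‖x‖ ^ 2 / 2)

theorem gaussianDensity_pos (x : EuclideanSpace ℝ (Fin d)) : 0 < gaussianDensity d x := by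
  unfold gaussianDensity; positivity

theorem contDiff_gaussianDensity : ContDiff ℝ ∞ (gaussianDensity d) := by
  unfold gaussianDensity
  exact contDiff_const.mul (((contDiff_norm_sq ℝ).neg.div_const 2).exp)

theorem fderiv_gaussianDensity_single (x : EuclideanSpace ℝ (Fin d)) (i : Fin d) :
    fderiv ℝ (gaussianDensity d) x (EuclideanSpace.single i 1) = -(x i * gaussianDensity d x) := by
  have h := ((((hasStrictFDerivAt_norm_sq x).hasFDerivAt.neg.mul_const (2⁻¹ : ℝ)).exp).const_mul
    ((2 * Real.pi) ^ (-(d : ℝ) / 2)))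
  have h' : HasFDerivAt (gaussianDensity d) _ x := h
  rw [h'.fderiv, gaussianDensity]
  simp [EuclideanSpace.inner_single_right, div_eq_mul_inv]
  ring

theorem gaussianMeasure_eq_withDensity :
    gaussianMeasure d = volume.withDensity fun x => ENNReal.ofReal (gaussianDensity d x) := rfl

theorem measurable_ofReal_gaussianDensity :
    Measurable fun x => ENNReal.ofReal (gaussianDensity d x) :=
  contDiff_gaussianDensity.continuous.measurable.ennreal_ofReal

theorem integral_gaussianMeasure (f : EuclideanSpace ℝ (Fin d) → ℝ) :
    ∫ x, f x ∂(gaussianMeasure d) = ∫ x, f x * gaussianDensity d x := by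
  rw [gaussianMeasure_eq_withDensity,
    integral_withDensity_eq_integral_toReal_smul measurable_ofReal_gaussianDensity (by simp)]
  refine integral_congr_ae (.of_forall fun x => ?_)
  simp only [ENNReal.toReal_ofReal (gaussianDensity_pos x).le, smul_eq_mul, mul_comm]

theorem integrable_gaussianMeasure_iff {f : EuclideanSpace ℝ (Fin d) → ℝ} :
    Integrable f (gaussianMeasure d) ↔ Integrable fun x => f x * gaussianDensity d x := by
  rw [gaussianMeasure_eq_withDensity,
    integrable_withDensity_iff measurable_ofReal_gaussianDensity (by simp)]
  simp only [ENNReal.toReal_ofReal (gaussianDensity_pos _).le]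

theorem integrable_exp_neg_mul_sq_norm {b : ℝ} (hb : 0 < b) :
    Integrable fun x : EuclideanSpace ℝ (Fin d) => Real.exp (-b * ‖x‖ ^ 2) := by
  have h := (GaussianFourier.integrable_cexp_neg_mul_sq_norm_add
    (V := EuclideanSpace ℝ (Fin d)) (b := b) (by simpa using hb) 0 0).norm
  refine h.congr (.of_forall fun x => ?_)
  simp [Complex.norm_exp, ← Complex.ofReal_pow]

theorem integrable_exp_mul_norm (a : ℝ) :
    Integrable (fun x => Real.exp (a * ‖x‖)) (gaussianMeasure d) := by
  rw [integrable_gaussianMeasure_iff]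
  -- With `t = ‖x‖`, `(a - t/2)² ≥ 0` gives `a t - t²/2 ≤ a² - t²/4`; half of the Gaussian decay
  -- absorbs the exponential.
  refine ((integrable_exp_neg_mul_sq_norm (d := d) (b := 1 / 4) (by norm_num)).const_mul
    ((2 * Real.pi) ^ (-(d : ℝ) / 2) * Real.exp (a ^ 2))).mono' ?_ (.of_forall fun x => ?_)
  · exact ((by fun_prop : Continuous fun x : EuclideanSpace ℝ (Fin d) => Real.exp (a * ‖x‖)).mul
      contDiff_gaussianDensity.continuous).aestronglyMeasurable
  · rw [Real.norm_of_nonneg (mul_nonneg (Real.exp_pos _).le (gaussianDensity_pos x).le),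
      gaussianDensity, mul_left_comm, ← Real.exp_add, mul_assoc, ← Real.exp_add]
    refine mul_le_mul_of_nonneg_left (Real.exp_le_exp.2 ?_) (by positivity)
    nlinarith [sq_nonneg (a - ‖x‖ / 2)]

instance isProbabilityMeasure_gaussianMeasure : IsProbabilityMeasure (gaussianMeasure d) := by
  have hi : Integrable (gaussianDensity d) := by
    have h := (integrable_gaussianMeasure_iff (d := d)).1 (integrable_exp_mul_norm 0)
    simpa only [zero_mul, Real.exp_zero, one_mul] using h
  refine ⟨?_⟩
  rw [gaussianMeasure_eq_withDensity, withDensity_apply _ MeasurableSet.univ, Measure.restrict_univ,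
    ← ofReal_integral_eq_lintegral_ofReal hi (.of_forall fun x => (gaussianDensity_pos x).le)]
  have h := GaussianFourier.integral_rexp_neg_mul_sq_norm (V := EuclideanSpace ℝ (Fin d))
    (b := 1 / 2) (by norm_num)
  have h2 : ∫ x, gaussianDensity d x = 1 := by
    have : gaussianDensity d = fun x => (2 * Real.pi) ^ (-(d : ℝ) / 2) *
        Real.exp (-(1 / 2) * ‖x‖ ^ 2) := by
      funext x; rw [gaussianDensity]; ring_nf
    rw [this, integral_const_mul, h, finrank_euclideanSpace_fin,
      show Real.pi / (1 / 2) = 2 * Real.pi by ring, ← Real.rpow_add (by positivity)]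
    rw [show -(d : ℝ) / 2 + d / 2 = 0 by ring, Real.rpow_zero]
  rw [h2, ENNReal.ofReal_one]

theorem gaussianMeasure_absolutelyContinuous : gaussianMeasure d ≪ volume :=
  withDensity_absolutelyContinuous _ _

theorem ExpBounded.memLp_two {f : EuclideanSpace ℝ (Fin d) → ℝ} (hf : ExpBounded f)
    (hc : Continuous f) : MemLp f 2 (gaussianMeasure d) := by
  rw [memLp_two_iff_integrable_sq hc.aestronglyMeasurable]
  obtain ⟨C, a, -, -, h⟩ := hf.mul hf
  refine ((integrable_exp_mul_norm a).const_mul C).mono' (hc.pow 2).aestronglyMeasurable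
    (.of_forall fun x => ?_)
  simpa [sq] using h x

theorem memLp_hermiteTensor (k : Fin d → ℕ) : MemLp (hermiteTensor k) 2 (gaussianMeasure d) :=
  (ExpBounded.hermiteTensor k).memLp_two (contDiff_hermiteTensor k).continuous

end GaussianMeasure

/-! ### Integration by parts for weak gradients. -/

section WeakGradient

variable {d : ℕ}

/-- Dilates `f(x / (m + 1))` of one bump function: the gradient picks up a factor `1 / (m + 1)`, so
it is uniformly bounded and tends to zero. -/
theorem exists_smooth_cutoff (E : Type*) [NormedAddCommGroup E] [InnerProductSpace ℝ E]
    [FiniteDimensional ℝ E] : ∃ (χ : ℕ → E → ℝ) (M : ℝ), (∀ m, ContDiff ℝ ∞ (χ m)) ∧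
      (∀ m, HasCompactSupport (χ m)) ∧ (∀ m x, |χ m x| ≤ 1) ∧
      (∀ m x, ‖fderiv ℝ (χ m) x‖ ≤ M) ∧
      (∀ x, Filter.Tendsto (fun m => χ m x) Filter.atTop (nhds 1)) ∧
      (∀ x, Filter.Tendsto (fun m => fderiv ℝ (χ m) x) Filter.atTop (nhds 0)) := by
  let f : ContDiffBump (0 : E) := ⟨1, 2, one_pos, one_lt_two⟩
  have hf : ContDiff ℝ ∞ f := f.contDiff
  have hfd : Continuous (fderiv ℝ f) := hf.continuous_fderiv (by simp)
  obtain ⟨M, hM⟩ := hfd.bounded_above_of_compact_support (f.hasCompactSupport.fderiv ℝ)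
  have hM0 : 0 ≤ M := (norm_nonneg _).trans (hM 0)
  let c : ℕ → ℝ := fun m => ((m : ℝ) + 1)⁻¹
  have hc : Filter.Tendsto c Filter.atTop (nhds 0) := by
    simpa [c] using tendsto_one_div_add_atTop_nhds_zero_nat (𝕜 := ℝ)
  have hc0 (m : ℕ) : 0 < c m := by positivity
  have hc1 (m : ℕ) : c m ≤ 1 := inv_le_one_of_one_le₀ (by simp)
  have hder (m : ℕ) (x : E) : fderiv ℝ (fun x => f (c m • x)) x = c m • fderiv ℝ f (c m • x) :=
    fderiv_comp_smul (c m)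
  have hle (m : ℕ) (x : E) : ‖fderiv ℝ (fun x => f (c m • x)) x‖ ≤ c m * M := by
    rw [hder, norm_smul, Real.norm_of_nonneg (hc0 m).le]
    exact mul_le_mul_of_nonneg_left (hM _) (hc0 m).le
  refine ⟨fun m x => f (c m • x), M, fun m => hf.comp (contDiff_const_smul (c m)),
    fun m => f.hasCompactSupport.comp_smul (hc0 m).ne', fun m x => ?_, fun m x => ?_, fun x => ?_,
    fun x => ?_⟩
  · rw [abs_of_nonneg f.nonneg]
    exact f.le_one
  · exact (hle m x).trans (mul_le_of_le_one_left hM0 (hc1 m))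
  · have h1 : f 0 = 1 := f.one_of_mem_closedBall (by simp [f])
    rw [← h1]
    refine (f.continuous.tendsto 0).comp ?_
    simpa using hc.smul_const x
  · refine squeeze_zero_norm (hle · x) ?_
    simpa using hc.mul_const M

/-- Gaussian integration by parts for a weakly differentiable function against a smooth function
of exponential growth. -/
theorem HasWeakGradient.integral_grad_mul {w : EuclideanSpace ℝ (Fin d) → ℝ}
    {g : EuclideanSpace ℝ (Fin d) → EuclideanSpace ℝ (Fin d)} (h : HasWeakGradient w g) (i : Fin d)
    (hw : MemLp w 2 (gaussianMeasure d)) (hg : MemLp (fun x => g x i) 2 (gaussianMeasure d))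
    {v : EuclideanSpace ℝ (Fin d) → ℝ} (hv : ContDiff ℝ ∞ v)
    (hv0 : MemLp v 2 (gaussianMeasure d))
    (hv1 : MemLp (fun x => x i * v x - fderiv ℝ v x (EuclideanSpace.single i 1)) 2
      (gaussianMeasure d)) :
    ∫ x, g x i * v x ∂(gaussianMeasure d) =
      ∫ x, w x * (x i * v x - fderiv ℝ v x (EuclideanSpace.single i 1)) ∂(gaussianMeasure d) := by
  obtain ⟨χ, M, hχ, hχc, hχ1, hχM, hχt, hχt'⟩ :=
    exists_smooth_cutoff (EuclideanSpace ℝ (Fin d))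
  set e : EuclideanSpace ℝ (Fin d) := EuclideanSpace.single i 1 with he
  have hen : ‖e‖ = 1 := by simp [he]
  set u := fun x => x i * v x - fderiv ℝ v x e with hu
  have hwv : Integrable (fun x => w x * v x) (gaussianMeasure d) := hw.integrable_mul hv0
  have hwu : Integrable (fun x => w x * u x) (gaussianMeasure d) := hw.integrable_mul hv1
  have hgv : Integrable (fun x => g x i * v x) (gaussianMeasure d) := hg.integrable_mul hv0
  have hpart (m : ℕ) : ∫ x, (w x * v x * fderiv ℝ (χ m) x e - w x * u x * χ m x)
      ∂(gaussianMeasure d) = -∫ x, g x i * v x * χ m x ∂(gaussianMeasure d) := by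
    rw [integral_gaussianMeasure, integral_gaussianMeasure]
    -- The density goes into the test function: its derivative `-xᵢ` times itself produces the `xᵢ
    -- v` term of `u`, and the cutoff supplies compact support.
    have hφ : ContDiff ℝ ∞ fun x => χ m x * (v x * gaussianDensity d x) :=
      (hχ m).mul (hv.mul contDiff_gaussianDensity)
    have key := h.integral_eq _ hφ ((hχc m).mul_right) i
    convert key using 2
    · funext x
      have d1 : DifferentiableAt ℝ (χ m) x := (hχ m).differentiable (by simp) x
      have d2 : DifferentiableAt ℝ v x := hv.differentiable (by simp) x
      have d3 : DifferentiableAt ℝ (gaussianDensity d) x :=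
        contDiff_gaussianDensity.differentiable (by simp) x
      rw [fderiv_fun_mul d1 (d2.fun_mul d3), fderiv_fun_mul d2 d3]
      simp only [add_apply, smul_apply, smul_eq_mul,
        fderiv_gaussianDensity_single, hu, he]
      ring
    · congr 1
      funext x
      ring
  -- Removal of the cutoff by dominated convergence; products of two `L²(μ)` functions serve as
  -- majorants.
  have lim1 : Filter.Tendsto (fun m => ∫ x, (w x * v x * fderiv ℝ (χ m) x e - w x * u x * χ m x)
      ∂(gaussianMeasure d)) Filter.atTop
      (nhds (∫ x, (w x * v x * 0 - w x * u x * 1) ∂(gaussianMeasure d))) := by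
    refine tendsto_integral_of_dominated_convergence
      (fun x => |w x * v x| * M + |w x * u x|) (fun m => ?_)
      ((hwv.abs.mul_const M).add hwu.abs) (fun m => .of_forall fun x => ?_)
      (.of_forall fun x => ?_)
    · have c1 : Continuous fun x => fderiv ℝ (χ m) x e :=
        ((hχ m).continuous_fderiv (by simp)).clm_apply continuous_const
      exact (hwv.aestronglyMeasurable.mul c1.aestronglyMeasurable).sub
        (hwu.aestronglyMeasurable.mul (hχ m).continuous.aestronglyMeasurable)
    · have b1 : |fderiv ℝ (χ m) x e| ≤ M := by
        have := (fderiv ℝ (χ m) x).le_opNorm e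
        rw [hen, mul_one] at this
        exact this.trans (hχM m x)
      refine (norm_sub_le _ _).trans (add_le_add ?_ ?_)
      · rw [norm_mul, Real.norm_eq_abs, Real.norm_eq_abs]
        gcongr
      · rw [norm_mul, Real.norm_eq_abs, Real.norm_eq_abs]
        exact mul_le_of_le_one_right (abs_nonneg _) (hχ1 m x)
    · refine ((Filter.Tendsto.const_mul _ ?_).sub ((hχt x).const_mul _))
      have := ((ContinuousLinearMap.apply ℝ ℝ e).continuous.tendsto 0).comp (hχt' x)
      simpa [Function.comp_def] using this
  have lim2 : Filter.Tendsto (fun m => ∫ x, g x i * v x * χ m x ∂(gaussianMeasure d)) Filter.atTop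
      (nhds (∫ x, g x i * v x * 1 ∂(gaussianMeasure d))) := by
    refine tendsto_integral_of_dominated_convergence (fun x => |g x i * v x|) (fun m => ?_)
      hgv.abs (fun m => .of_forall fun x => ?_) (.of_forall fun x => (hχt x).const_mul _)
    · exact hgv.aestronglyMeasurable.mul (hχ m).continuous.aestronglyMeasurable
    · rw [norm_mul, Real.norm_eq_abs, Real.norm_eq_abs]
      exact mul_le_of_le_one_right (abs_nonneg _) (hχ1 m x)
  simp only [hpart] at lim1
  have := tendsto_nhds_unique lim1 lim2.neg
  simp only [mul_zero, mul_one, zero_sub, integral_neg, neg_inj] at this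
  exact this.symm

/-- The adjoint `xᵢ - ∂ᵢ` raises `H_k` to a multiple of `H_{k + eᵢ}`, so differentiation acts on
Hermite coefficients as a weighted shift. -/
theorem HasWeakGradient.integral_grad_mul_hermiteTensor {w : EuclideanSpace ℝ (Fin d) → ℝ}
    {g : EuclideanSpace ℝ (Fin d) → EuclideanSpace ℝ (Fin d)} (h : HasWeakGradient w g) (i : Fin d)
    (hw : MemLp w 2 (gaussianMeasure d)) (hg : MemLp (fun x => g x i) 2 (gaussianMeasure d))
    (k : Fin d → ℕ) :
    ∫ x, g x i * hermiteTensor k x ∂(gaussianMeasure d) = √((k i : ℝ) + 1) *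
      ∫ x, w x * hermiteTensor (Function.update k i (k i + 1)) x ∂(gaussianMeasure d) := by
  have hk : (fun x => x i * hermiteTensor k x -
      fderiv ℝ (hermiteTensor k) x (EuclideanSpace.single i 1)) =
      fun x => √((k i : ℝ) + 1) * hermiteTensor (Function.update k i (k i + 1)) x := by
    funext x
    rw [fderiv_hermiteTensor_single, sqrt_mul_hermiteTensor_update_succ]
  rw [h.integral_grad_mul i hw hg (contDiff_hermiteTensor k) (memLp_hermiteTensor k)
    (by rw [hk]; exact (memLp_hermiteTensor _).const_mul _), ← integral_const_mul]
  refine integral_congr_ae (.of_forall fun x => ?_)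
  have := congrFun hk x
  simp only at this ⊢
  rw [this]
  ring

theorem HasWeakGradient.of_contDiff {w : EuclideanSpace ℝ (Fin d) → ℝ}
    {g : EuclideanSpace ℝ (Fin d) → EuclideanSpace ℝ (Fin d)} (hw : ContDiff ℝ ∞ w)
    (hg : Continuous g) (h : ∀ x i, g x i = fderiv ℝ w x (EuclideanSpace.single i 1)) :
    HasWeakGradient w g where
  locallyIntegrable := hw.continuous.locallyIntegrable
  locallyIntegrable_grad := hg.locallyIntegrable
  integral_eq φ hφ hφc i := by
    simp only [h]
    have c1 : Continuous fun x => fderiv ℝ w x (EuclideanSpace.single i 1) :=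
      (hw.continuous_fderiv (by simp)).clm_apply continuous_const
    have c2 : Continuous fun x => fderiv ℝ φ x (EuclideanSpace.single i 1) :=
      (hφ.continuous_fderiv (by simp)).clm_apply continuous_const
    refine integral_mul_fderiv_eq_neg_fderiv_mul_of_integrable ?_ ?_ ?_ ?_ ?_
    · exact (c1.mul hφ.continuous).integrable_of_hasCompactSupport hφc.mul_left
    · exact (hw.continuous.mul c2).integrable_of_hasCompactSupport
        ((hφc.fderiv_apply ℝ _).mul_left)
    · exact (hw.continuous.mul hφ.continuous).integrable_of_hasCompactSupport hφc.mul_left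
    · exact fun x _ => hw.differentiable (by simp) x
    · exact fun x _ => hφ.differentiable (by simp) x

end WeakGradient

/-! ### Orthonormality of the Hermite system. -/

section Orthonormality

variable {d : ℕ}

theorem hasWeakGradient_hermiteTensor (k : Fin d → ℕ) :
    HasWeakGradient (hermiteTensor k) fun x => WithLp.toLp 2 fun i =>
      √(k i : ℝ) * hermiteTensor (Function.update k i (k i - 1)) x := by
  refine .of_contDiff (contDiff_hermiteTensor k) ?_ fun x i => ?_
  · refine (PiLp.continuous_toLp 2 _).comp (continuous_pi fun i => ?_)
    exact continuous_const.mul (contDiff_hermiteTensor _).continuous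
  · rw [fderiv_hermiteTensor_single]

/-- The integration by parts applied to `w = H_k`: lowering one factor is adjoint to raising the
other. -/
theorem sqrt_mul_integral_hermiteTensor_update_pred (k l : Fin d → ℕ) (i : Fin d) :
    √(k i : ℝ) * ∫ x, hermiteTensor (Function.update k i (k i - 1)) x * hermiteTensor l x
      ∂(gaussianMeasure d) = √((l i : ℝ) + 1) *
      ∫ x, hermiteTensor k x * hermiteTensor (Function.update l i (l i + 1)) x
        ∂(gaussianMeasure d) := by
  rw [← (hasWeakGradient_hermiteTensor k).integral_grad_mul_hermiteTensor i
    (memLp_hermiteTensor k) ((memLp_hermiteTensor _).const_mul _), ← integral_const_mul]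
  simp only [mul_assoc]

theorem integral_hermiteTensor_of_ne_zero {k : Fin d → ℕ} (hk : k ≠ 0) :
    ∫ x, hermiteTensor k x ∂(gaussianMeasure d) = 0 := by
  obtain ⟨i, hi⟩ := Function.ne_iff.1 hk
  obtain ⟨m, hm⟩ : ∃ m, k i = m + 1 := Nat.exists_eq_succ_of_ne_zero hi
  -- Pairing with the constant `H_0 = 1`, which lowering annihilates.
  have h := sqrt_mul_integral_hermiteTensor_update_pred 0 (Function.update k i m) i
  have hkk : Function.update (Function.update k i m) i (Function.update k i m i + 1) = k := by
    simp [← hm]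
  rw [hkk] at h
  simp only [Pi.zero_apply, Nat.cast_zero, Real.sqrt_zero, zero_mul, hermiteTensor_zero,
    one_mul] at h
  exact (mul_eq_zero.1 h.symm).resolve_left (Real.sqrt_pos.2 (by positivity)).ne'

/-- Induction on `|l|`: adjointness removes one unit from the same coordinate of both indices. -/
theorem integral_hermiteTensor_mul_hermiteTensor (k l : Fin d → ℕ) :
    ∫ x, hermiteTensor k x * hermiteTensor l x ∂(gaussianMeasure d) = if k = l then 1 else 0 := by
  induction hN : ∑ j, l j generalizing k l with
  | zero =>
    obtain rfl : l = 0 := by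
      funext j
      exact Finset.sum_eq_zero_iff.1 hN j (Finset.mem_univ j)
    simp only [hermiteTensor_zero, mul_one]
    split_ifs with hk
    · simp [hk, hermiteTensor_zero]
    · exact integral_hermiteTensor_of_ne_zero hk
  | succ N ih =>
    obtain ⟨i, -, hi⟩ : ∃ i ∈ Finset.univ, l i ≠ 0 := Finset.exists_ne_zero_of_sum_ne_zero (by omega)
    obtain ⟨m, hm⟩ : ∃ m, l i = m + 1 := Nat.exists_eq_succ_of_ne_zero hi
    have hll : Function.update (Function.update l i m) i (Function.update l i m i + 1) = l := by
      simp [← hm]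
    have hs : ∑ j, Function.update l i m j = N := by
      rw [Finset.sum_update_of_mem (Finset.mem_univ i)]
      rw [← Finset.add_sum_erase _ _ (Finset.mem_univ i), hm, Finset.erase_eq] at hN
      omega
    have h := sqrt_mul_integral_hermiteTensor_update_pred k (Function.update l i m) i
    rw [hll, ih _ _ hs, Function.update_self] at h
    have hpos : 0 < √((m : ℝ) + 1) := Real.sqrt_pos.2 (by positivity)
    by_cases hkl : k = l
    · subst hkl
      rw [hm, if_pos (by simp)] at h
      rw [if_pos rfl]
      push_cast at h
      exact (mul_left_cancel₀ hpos.ne' h).symm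
    · rw [if_neg hkl]
      refine (mul_eq_zero.1 (h.symm.trans ?_)).resolve_left hpos.ne'
      -- If `k i = 0`, lowering gives zero; otherwise both `i`-th entries drop by one and the
      -- indices remain different.
      rcases Nat.eq_zero_or_pos (k i) with h0 | h0
      · simp [h0]
      · rw [if_neg, mul_zero]
        intro hu
        apply hkl
        funext j
        have hj := congrFun hu j
        by_cases hji : j = i
        · subst hji
          simp only [Function.update_self] at hj
          omega
        · simpa [hji] using hj

end Orthonormality

/-! ### Completeness of the Hermite system. -/

section Completeness

variable {d : ℕ}

/-- By the three-term recurrence, `xᵢ H_k` combines the raised and lowered `H_k`. Iterating this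
puts all powers `⟨x, ξ⟩ⁿ` in the span. -/
theorem coord_mul_mem_span_hermiteTensor {p : EuclideanSpace ℝ (Fin d) → ℝ}
    (hp : p ∈ Submodule.span ℝ (Set.range (hermiteTensor (d := d)))) (i : Fin d) :
    (fun x => x i * p x) ∈ Submodule.span ℝ (Set.range (hermiteTensor (d := d))) := by
  induction hp using Submodule.span_induction with
  | mem p hp =>
    obtain ⟨k, rfl⟩ := hp
    have h : (fun x : EuclideanSpace ℝ (Fin d) => x i * hermiteTensor k x) =
        √((k i : ℝ) + 1) • hermiteTensor (Function.update k i (k i + 1)) +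
          √(k i : ℝ) • hermiteTensor (Function.update k i (k i - 1)) := by
      funext x
      simp only [Pi.add_apply, Pi.smul_apply, smul_eq_mul, sqrt_mul_hermiteTensor_update_succ]
      ring
    rw [h]
    exact add_mem (Submodule.smul_mem _ _ (Submodule.subset_span ⟨_, rfl⟩))
      (Submodule.smul_mem _ _ (Submodule.subset_span ⟨_, rfl⟩))
  | zero =>
    convert Submodule.zero_mem _ using 1
    funext x
    simp
  | add p q _ _ hp hq =>
    convert add_mem hp hq using 1
    funext x
    simp only [Pi.add_apply, mul_add]
  | smul c p _ hp =>
    convert Submodule.smul_mem _ c hp using 1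
    funext x
    simp only [Pi.smul_apply, smul_eq_mul]
    ring

theorem inner_pow_mem_span_hermiteTensor (ξ : EuclideanSpace ℝ (Fin d)) (n : ℕ) :
    (fun x : EuclideanSpace ℝ (Fin d) => (inner ℝ x ξ) ^ n) ∈
      Submodule.span ℝ (Set.range (hermiteTensor (d := d))) := by
  induction n with
  | zero =>
    refine Submodule.subset_span ⟨0, ?_⟩
    funext x
    simp [hermiteTensor_zero]
  | succ n ih =>
    have h : (fun x : EuclideanSpace ℝ (Fin d) => (inner ℝ x ξ) ^ (n + 1)) =
        ∑ i, ξ i • fun x : EuclideanSpace ℝ (Fin d) => x i * (inner ℝ x ξ) ^ n := by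
      funext x
      simp only [Finset.sum_apply, Pi.smul_apply, smul_eq_mul, ← mul_assoc, ← Finset.sum_mul]
      rw [pow_succ', PiLp.inner_apply]
      simp
    rw [h]
    exact Submodule.sum_mem _ fun i _ =>
      Submodule.smul_mem _ _ (coord_mul_mem_span_hermiteTensor ih i)

theorem integral_mul_eq_zero_of_mem_span_hermiteTensor {f p : EuclideanSpace ℝ (Fin d) → ℝ}
    (hf : MemLp f 2 (gaussianMeasure d))
    (h : ∀ k : Fin d → ℕ, ∫ x, f x * hermiteTensor k x ∂(gaussianMeasure d) = 0)
    (hp : p ∈ Submodule.span ℝ (Set.range (hermiteTensor (d := d)))) :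
    MemLp p 2 (gaussianMeasure d) ∧ ∫ x, f x * p x ∂(gaussianMeasure d) = 0 := by
  induction hp using Submodule.span_induction with
  | mem p hp =>
    obtain ⟨k, rfl⟩ := hp
    exact ⟨memLp_hermiteTensor k, h k⟩
  | zero => simp
  | add p q _ _ hp hq =>
    refine ⟨hp.1.add hq.1, ?_⟩
    simp only [Pi.add_apply, mul_add]
    refine (integral_add (hf.integrable_mul hp.1) (hf.integrable_mul hq.1)).trans ?_
    simp only [Pi.mul_apply, hp.2, hq.2, add_zero]
  | smul c p _ hp =>
    refine ⟨hp.1.const_smul c, ?_⟩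
    simp only [Pi.smul_apply, smul_eq_mul, mul_left_comm _ c]
    rw [integral_const_mul, hp.2, mul_zero]

/-- Expand the exponential in powers of `⟨x, ξ⟩`, each orthogonal to `f`. The interchange of sum and
integral is dominated by `|f| exp|⟨x, ξ⟩|`, a product of two `L²(μ)` functions. -/
theorem integral_mul_cexp_inner_eq_zero {f : EuclideanSpace ℝ (Fin d) → ℝ}
    (hf : MemLp f 2 (gaussianMeasure d))
    (h : ∀ k : Fin d → ℕ, ∫ x, f x * hermiteTensor k x ∂(gaussianMeasure d) = 0)
    (ξ : EuclideanSpace ℝ (Fin d)) :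
    ∫ x, (f x : ℂ) * Complex.exp (inner ℝ x ξ * Complex.I) ∂(gaussianMeasure d) = 0 := by
  have hinner : Continuous fun x : EuclideanSpace ℝ (Fin d) => (inner ℝ x ξ : ℝ) := by fun_prop
  have hexp : MemLp (fun x => Real.exp |inner ℝ x ξ|) 2 (gaussianMeasure d) := by
    refine ExpBounded.memLp_two ⟨1, ‖ξ‖, zero_le_one, norm_nonneg _, fun x => ?_⟩
      (Real.continuous_exp.comp hinner.abs)
    rw [abs_of_pos (Real.exp_pos _), one_mul, mul_comm]
    exact Real.exp_le_exp.2 (abs_real_inner_le_norm x ξ)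
  have hsum : HasSum (fun n : ℕ => ∫ x, (f x : ℂ) *
      ((n.factorial : ℂ)⁻¹ * (inner ℝ x ξ * Complex.I) ^ n) ∂(gaussianMeasure d))
      (∫ x, (f x : ℂ) * Complex.exp (inner ℝ x ξ * Complex.I) ∂(gaussianMeasure d)) := by
    have hreal (x : EuclideanSpace ℝ (Fin d)) : HasSum (fun n : ℕ =>
        |f x| * ((n.factorial : ℝ)⁻¹ * |inner ℝ x ξ| ^ n)) (|f x| * Real.exp |inner ℝ x ξ|) := by
      refine HasSum.mul_left _ ?_
      rw [Real.exp_eq_exp_ℝ]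
      simpa using NormedSpace.exp_series_hasSum_exp' (𝕂 := ℝ) |inner ℝ x ξ|
    refine hasSum_integral_of_dominated_convergence
      (fun n x => |f x| * ((n.factorial : ℝ)⁻¹ * |inner ℝ x ξ| ^ n)) (fun n => ?_)
      (fun n => .of_forall fun x => ?_) (.of_forall fun x => (hreal x).summable) ?_
      (.of_forall fun x => ?_)
    · refine (Complex.continuous_ofReal.comp_aestronglyMeasurable hf.aestronglyMeasurable).mul ?_
      exact Continuous.aestronglyMeasurable (by fun_prop)
    · simp
    · simp only [fun x => (hreal x).tsum_eq]
      exact hf.abs.integrable_mul hexp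
    · refine HasSum.mul_left _ ?_
      rw [Complex.exp_eq_exp_ℂ]
      simpa using NormedSpace.exp_series_hasSum_exp' (𝕂 := ℂ) (inner ℝ x ξ * Complex.I)
  have hzero (n : ℕ) : ∫ x, (f x : ℂ) *
      ((n.factorial : ℂ)⁻¹ * (inner ℝ x ξ * Complex.I) ^ n) ∂(gaussianMeasure d) = 0 := by
    have h1 := (integral_mul_eq_zero_of_mem_span_hermiteTensor hf h
      (inner_pow_mem_span_hermiteTensor ξ n)).2
    have h2 : (fun x => (f x : ℂ) * ((n.factorial : ℂ)⁻¹ * (inner ℝ x ξ * Complex.I) ^ n)) =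
        fun x => ((n.factorial : ℂ)⁻¹ * Complex.I ^ n) * ((f x * inner ℝ x ξ ^ n : ℝ) : ℂ) := by
      funext x
      push_cast
      ring
    rw [h2, integral_const_mul, integral_complex_ofReal, h1, Complex.ofReal_zero, mul_zero]
  simp only [hzero] at hsum
  exact hsum.unique hasSum_zero

/-- The positive and negative parts of `f` are densities of two finite measures with equal
characteristic functions. The measures coincide, so `f⁺ = f⁻` almost everywhere. -/
theorem ae_eq_zero_of_integral_mul_hermiteTensor_eq_zero {f : EuclideanSpace ℝ (Fin d) → ℝ}
    (hf : MemLp f 2 (gaussianMeasure d))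
    (h : ∀ k : Fin d → ℕ, ∫ x, f x * hermiteTensor k x ∂(gaussianMeasure d) = 0) :
    f =ᵐ[gaussianMeasure d] 0 := by
  have hi : Integrable f (gaussianMeasure d) := hf.integrable (by norm_num)
  have hm : AEMeasurable (fun x => ENNReal.ofReal (f x)) (gaussianMeasure d) :=
    hi.aemeasurable.ennreal_ofReal
  have hm' : AEMeasurable (fun x => ENNReal.ofReal (-f x)) (gaussianMeasure d) :=
    hi.neg.aemeasurable.ennreal_ofReal
  have hfin : ∫⁻ x, ENNReal.ofReal (f x) ∂(gaussianMeasure d) ≠ ⊤ := hi.lintegral_lt_top.ne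
  have hfin' : ∫⁻ x, ENNReal.ofReal (-f x) ∂(gaussianMeasure d) ≠ ⊤ := hi.neg.lintegral_lt_top.ne
  have : IsFiniteMeasure ((gaussianMeasure d).withDensity fun x => ENNReal.ofReal (f x)) :=
    isFiniteMeasure_withDensity hfin
  have : IsFiniteMeasure ((gaussianMeasure d).withDensity fun x => ENNReal.ofReal (-f x)) :=
    isFiniteMeasure_withDensity hfin'
  have heq : ((gaussianMeasure d).withDensity fun x => ENNReal.ofReal (f x)) =
      (gaussianMeasure d).withDensity fun x => ENNReal.ofReal (-f x) := by
    refine Measure.ext_of_charFun ?_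
    funext ξ
    rw [charFun_apply, charFun_apply, integral_withDensity_eq_integral_toReal_smul₀ hm (by simp),
      integral_withDensity_eq_integral_toReal_smul₀ hm' (by simp), ← sub_eq_zero, ← integral_sub]
    · rw [← integral_mul_cexp_inner_eq_zero hf h ξ]
      refine integral_congr_ae (.of_forall fun x => ?_)
      simp only [ENNReal.toReal_ofReal', Complex.real_smul, ← sub_mul]
      congr 1
      rw [← Complex.ofReal_sub, max_zero_sub_max_neg_zero_eq_self]
    all_goals
      refine Integrable.mono' hi.abs ?_ (.of_forall fun x => ?_)
    · exact hm.ennreal_toReal.aestronglyMeasurable.smul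
        (Continuous.aestronglyMeasurable (by fun_prop))
    · rw [norm_smul, Complex.norm_exp_ofReal_mul_I, mul_one, ENNReal.toReal_ofReal',
        Real.norm_of_nonneg (le_max_right _ _)]
      exact max_le (le_abs_self _) (abs_nonneg _)
    · exact hm'.ennreal_toReal.aestronglyMeasurable.smul
        (Continuous.aestronglyMeasurable (by fun_prop))
    · rw [norm_smul, Complex.norm_exp_ofReal_mul_I, mul_one, ENNReal.toReal_ofReal',
        Real.norm_of_nonneg (le_max_right _ _)]
      exact max_le (neg_le_abs _) (abs_nonneg _)
  filter_upwards [(withDensity_eq_iff hm hm' hfin).1 heq] with x hx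
  have h1 := congrArg ENNReal.toReal hx
  rw [ENNReal.toReal_ofReal', ENNReal.toReal_ofReal'] at h1
  have h2 := max_zero_sub_max_neg_zero_eq_self (f x)
  simp only [Pi.zero_apply]
  linarith

end Completeness

/-! ### Hilbert basis and Parseval's identity. -/

section Parseval

variable {d : ℕ}

theorem inner_toLp_eq_integral_mul {f g : EuclideanSpace ℝ (Fin d) → ℝ}
    (hf : MemLp f 2 (gaussianMeasure d)) (hg : MemLp g 2 (gaussianMeasure d)) :
    inner ℝ (hf.toLp f) (hg.toLp g) = ∫ x, f x * g x ∂(gaussianMeasure d) := by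
  rw [L2.inner_def]
  refine integral_congr_ae ?_
  filter_upwards [hf.coeFn_toLp, hg.coeFn_toLp] with x h1 h2
  rw [h1, h2]
  simp [mul_comm]

theorem orthonormal_hermiteTensor :
    Orthonormal ℝ fun k : Fin d → ℕ => (memLp_hermiteTensor k).toLp (hermiteTensor k) := by
  classical
  rw [orthonormal_iff_ite]
  intro k l
  rw [inner_toLp_eq_integral_mul, integral_hermiteTensor_mul_hermiteTensor]

theorem orthogonal_span_hermiteTensor_eq_bot :
    (Submodule.span ℝ (Set.range fun k : Fin d → ℕ =>
      (memLp_hermiteTensor k).toLp (hermiteTensor k)))ᗮ = ⊥ := by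
  rw [Submodule.eq_bot_iff]
  intro f hf
  rw [Submodule.mem_orthogonal] at hf
  refine (Lp.eq_zero_iff_ae_eq_zero).2 (ae_eq_zero_of_integral_mul_hermiteTensor_eq_zero
    (Lp.memLp f) fun k => ?_)
  have h := hf _ (Submodule.subset_span ⟨k, rfl⟩)
  rw [real_inner_comm, ← Lp.toLp_coeFn f (Lp.memLp f), inner_toLp_eq_integral_mul] at h
  exact h

/-- Parseval's identity for the Hermite expansion. -/
theorem eLpNorm_sq_eq_tsum_hermite {f : EuclideanSpace ℝ (Fin d) → ℝ}
    (hf : MemLp f 2 (gaussianMeasure d)) :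
    eLpNorm f 2 (gaussianMeasure d) ^ 2 = ∑' k : Fin d → ℕ,
      ENNReal.ofReal ((∫ x, f x * hermiteTensor k x ∂(gaussianMeasure d)) ^ 2) := by
  let b := HilbertBasis.mkOfOrthogonalEqBot (orthonormal_hermiteTensor (d := d))
    orthogonal_span_hermiteTensor_eq_bot
  have h := b.hasSum_inner_mul_inner (hf.toLp f) (hf.toLp f)
  have hb (k : Fin d → ℕ) : b k = (memLp_hermiteTensor k).toLp (hermiteTensor k) :=
    congrFun (HilbertBasis.coe_mkOfOrthogonalEqBot _ _) k
  simp only [hb, fun k : Fin d → ℕ => real_inner_comm (hf.toLp f)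
    ((memLp_hermiteTensor k).toLp (hermiteTensor k)), ← sq] at h
  simp only [inner_toLp_eq_integral_mul hf (memLp_hermiteTensor _)] at h
  rw [real_inner_self_eq_norm_sq] at h
  rw [← ENNReal.ofReal_tsum_of_nonneg (fun k => sq_nonneg _) h.summable, h.tsum_eq, Lp.norm_toLp,
    ENNReal.ofReal_pow ENNReal.toReal_nonneg, ENNReal.ofReal_toReal hf.eLpNorm_ne_top]

end Parseval

/-! ### The gradient norm in Hermite coefficients, and the extremal functions. -/

section Poincare

variable {d : ℕ}

theorem eLpNorm_sq_eq_sum_coord (μ : Measure (EuclideanSpace ℝ (Fin d)))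
    {g : EuclideanSpace ℝ (Fin d) → EuclideanSpace ℝ (Fin d)} (hg : AEStronglyMeasurable g μ) :
    eLpNorm g 2 μ ^ 2 = ∑ i, eLpNorm (fun x => g x i) 2 μ ^ 2 := by
  have hsq {F : Type} [NormedAddCommGroup F] (f : EuclideanSpace ℝ (Fin d) → F) :
      eLpNorm f 2 μ ^ 2 = ∫⁻ x, ‖f x‖ₑ ^ 2 ∂μ := by
    simpa using eLpNorm_nnreal_pow_eq_lintegral (μ := μ) (f := f) (p := 2) two_ne_zero
  simp only [hsq]
  rw [← lintegral_finsetSum']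
  · refine lintegral_congr fun x => ?_
    simp only [← ofReal_norm, ← ENNReal.ofReal_pow (norm_nonneg _)]
    rw [EuclideanSpace.norm_sq_eq, ENNReal.ofReal_sum_of_nonneg fun i _ => sq_nonneg _]
  · intro i _
    have : AEStronglyMeasurable (fun x => g x i) μ :=
      (EuclideanSpace.proj (𝕜 := ℝ) i).continuous.comp_aestronglyMeasurable hg
    exact this.enorm.pow_const 2

/-- The shift `k ↦ k + eᵢ` is injective and misses only indices with `k i = 0`, where `F` vanishes.
-/
theorem tsum_update_succ_eq (i : Fin d) (F : (Fin d → ℕ) → ℝ≥0∞) (hF : ∀ k, k i = 0 → F k = 0) :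
    ∑' k : Fin d → ℕ, F (Function.update k i (k i + 1)) = ∑' k, F k := by
  have hinj : Function.Injective fun k : Fin d → ℕ => Function.update k i (k i + 1) := by
    intro k l h
    funext j
    have hj := congrFun h j
    by_cases hji : j = i
    · subst hji
      simpa using hj
    · simpa [hji] using hj
  refine hinj.tsum_eq fun k hk => ?_
  have h0 : k i ≠ 0 := fun h => hk (hF k h)
  refine ⟨Function.update k i (k i - 1), ?_⟩
  simp [Nat.sub_add_cancel (Nat.pos_of_ne_zero h0)]

/-- Parseval for each component of `g`, reindexed by the shift, gives weights `k i`; these add up to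
`|k|`. -/
theorem HasWeakGradient.eLpNorm_grad_sq_eq_tsum {w : EuclideanSpace ℝ (Fin d) → ℝ}
    {g : EuclideanSpace ℝ (Fin d) → EuclideanSpace ℝ (Fin d)} (h : HasWeakGradient w g)
    (hw : MemLp w 2 (gaussianMeasure d)) (hg : MemLp g 2 (gaussianMeasure d)) :
    eLpNorm g 2 (gaussianMeasure d) ^ 2 = ∑' k : Fin d → ℕ, ENNReal.ofReal ((∑ i, k i : ℕ) *
      (∫ x, w x * hermiteTensor k x ∂(gaussianMeasure d)) ^ 2) := by
  have hgi (i : Fin d) : MemLp (fun x => g x i) 2 (gaussianMeasure d) :=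
    (EuclideanSpace.proj (𝕜 := ℝ) i).comp_memLp' hg
  have hi (i : Fin d) : eLpNorm (fun x => g x i) 2 (gaussianMeasure d) ^ 2 =
      ∑' k : Fin d → ℕ, ENNReal.ofReal ((k i : ℝ) *
        (∫ x, w x * hermiteTensor k x ∂(gaussianMeasure d)) ^ 2) := by
    rw [eLpNorm_sq_eq_tsum_hermite (hgi i), ← tsum_update_succ_eq i (fun k =>
      ENNReal.ofReal ((k i : ℝ) * (∫ x, w x * hermiteTensor k x ∂(gaussianMeasure d)) ^ 2))
      fun k hk => by simp [hk]]
    refine tsum_congr fun k => ?_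
    rw [h.integral_grad_mul_hermiteTensor i hw (hgi i), mul_pow, Real.sq_sqrt (by positivity)]
    simp
  rw [eLpNorm_sq_eq_sum_coord _ hg.aestronglyMeasurable]
  simp only [hi]
  rw [← Summable.tsum_finsetSum fun i _ => ENNReal.summable]
  refine tsum_congr fun k => ?_
  rw [← ENNReal.ofReal_sum_of_nonneg fun i _ => by positivity, ← Finset.sum_mul]
  push_cast
  rfl

/-- Termwise comparison: subtracting `1` kills the coefficient at `k = 0`, the hypothesis kills
those with `0 < |k| < n`, and `n ≤ |k|` for the rest. -/
theorem HasWeakGradient.natCast_mul_eLpNorm_sub_one_sq_le {n : ℕ}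
    {w : EuclideanSpace ℝ (Fin d) → ℝ}
    {g : EuclideanSpace ℝ (Fin d) → EuclideanSpace ℝ (Fin d)} (h : HasWeakGradient w g)
    (hw : MemLp w 2 (gaussianMeasure d)) (hg : MemLp g 2 (gaussianMeasure d))
    (h1 : ∫ x, w x ∂(gaussianMeasure d) = 1)
    (horth : ∀ k : Fin d → ℕ, 0 < ∑ j, k j → ∑ j, k j < n →
      ∫ x, w x * hermiteTensor k x ∂(gaussianMeasure d) = 0) :
    (n : ℝ≥0∞) * eLpNorm (fun x => w x - 1) 2 (gaussianMeasure d) ^ 2 ≤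
      eLpNorm g 2 (gaussianMeasure d) ^ 2 := by
  have hw1 : MemLp (fun x => w x - 1) 2 (gaussianMeasure d) := hw.sub (memLp_const 1)
  rw [h.eLpNorm_grad_sq_eq_tsum hw hg, eLpNorm_sq_eq_tsum_hermite hw1, ← ENNReal.tsum_mul_left]
  refine ENNReal.tsum_le_tsum fun k => ?_
  rw [← ENNReal.ofReal_natCast, ← ENNReal.ofReal_mul (by positivity)]
  refine ENNReal.ofReal_le_ofReal ?_
  have hsub : ∫ x, (w x - 1) * hermiteTensor k x ∂(gaussianMeasure d) =
      ∫ x, w x * hermiteTensor k x ∂(gaussianMeasure d) -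
        ∫ x, hermiteTensor k x ∂(gaussianMeasure d) := by
    simp only [sub_mul, one_mul]
    exact integral_sub (hw.integrable_mul (memLp_hermiteTensor k))
      ((memLp_hermiteTensor k).integrable (by norm_num))
  rw [hsub]
  by_cases hk : k = 0
  · subst hk
    simp [hermiteTensor_zero, h1]
  · rw [integral_hermiteTensor_of_ne_zero hk, sub_zero]
    by_cases hkn : ∑ j, k j < n
    · have hpos : 0 < ∑ j, k j := by
        refine Nat.pos_of_ne_zero fun h0 => hk ?_
        funext j
        exact Finset.sum_eq_zero_iff.1 h0 j (Finset.mem_univ j)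
      simp [horth k hpos hkn]
    · gcongr
      exact not_lt.1 hkn

theorem eLpNorm_hermiteTensor_sq (k : Fin d → ℕ) :
    eLpNorm (hermiteTensor k) 2 (gaussianMeasure d) ^ 2 = 1 := by
  rw [eLpNorm_sq_eq_tsum_hermite (memLp_hermiteTensor k)]
  simp only [integral_hermiteTensor_mul_hermiteTensor]
  rw [tsum_eq_single k fun l hl => by simp [hl.symm]]
  simp

theorem eLpNorm_grad_hermiteTensor_sq (k : Fin d → ℕ) :
    eLpNorm (fun x => (WithLp.toLp 2 fun i =>
      √(k i : ℝ) * hermiteTensor (Function.update k i (k i - 1)) x : EuclideanSpace ℝ (Fin d))) 2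
      (gaussianMeasure d) ^ 2 = ((∑ i, k i : ℕ) : ℝ≥0∞) := by
  rw [eLpNorm_sq_eq_sum_coord _
    ((hasWeakGradient_hermiteTensor k).locallyIntegrable_grad.aestronglyMeasurable.mono_ac
      gaussianMeasure_absolutelyContinuous)]
  push_cast
  refine Finset.sum_congr rfl fun i _ => ?_
  have h := eLpNorm_const_smul (√(k i : ℝ)) (hermiteTensor (Function.update k i (k i - 1))) 2
    (gaussianMeasure d)
  refine (congrArg (· ^ 2) h).trans ?_
  simp only [mul_pow, eLpNorm_hermiteTensor_sq, mul_one]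
  rw [Real.enorm_of_nonneg (Real.sqrt_nonneg _), ← ENNReal.ofReal_pow (Real.sqrt_nonneg _),
    Real.sq_sqrt (by positivity), ENNReal.ofReal_natCast]

theorem hasWeakGradient_one_add_hermiteTensor (k : Fin d → ℕ) :
    HasWeakGradient (fun x => 1 + hermiteTensor k x) fun x => WithLp.toLp 2 fun i =>
      √(k i : ℝ) * hermiteTensor (Function.update k i (k i - 1)) x := by
  refine .of_contDiff (contDiff_const.add (contDiff_hermiteTensor k)) ?_ fun x i => ?_
  · refine (PiLp.continuous_toLp 2 _).comp (continuous_pi fun i => ?_)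
    exact continuous_const.mul (contDiff_hermiteTensor _).continuous
  · rw [fderiv_const_add, fderiv_hermiteTensor_single]

theorem integral_one_add_hermiteTensor_mul {k l : Fin d → ℕ} (hl : l ≠ 0) (hkl : k ≠ l) :
    ∫ x, (1 + hermiteTensor k x) * hermiteTensor l x ∂(gaussianMeasure d) = 0 := by
  simp only [add_mul, one_mul]
  refine (integral_add ((memLp_hermiteTensor l).integrable (by norm_num))
    ((memLp_hermiteTensor k).integrable_mul (memLp_hermiteTensor l))).trans ?_
  simp only [Pi.mul_apply]
  rw [integral_hermiteTensor_of_ne_zero hl, integral_hermiteTensor_mul_hermiteTensor, if_neg hkl,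
    add_zero]

end Poincare

/-! ### The sharp inequality. -/

theorem proposition1 (d n : ℕ) (hd : 0 < d) (hn : 0 < n) :
    IsLeast
      {C : ℝ≥0 |
        ∀ (w : EuclideanSpace ℝ (Fin d) → ℝ)
          (g : EuclideanSpace ℝ (Fin d) → EuclideanSpace ℝ (Fin d)),
          MemLp w 2 (gaussianMeasure d) →
          HasWeakGradient w g →
          ∫ x, w x ∂(gaussianMeasure d) = 1 →
          (∀ k : Fin d → ℕ, 0 < ∑ j, k j → ∑ j, k j < n →
            ∫ x, w x * hermiteTensor k x ∂(gaussianMeasure d) = 0) →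
          eLpNorm (fun x => w x - 1) 2 (gaussianMeasure d) ^ 2 ≤
            (C : ℝ≥0∞) * eLpNorm g 2 (gaussianMeasure d) ^ 2}
      (1 / (n : ℝ≥0)) := by
  have hn' : (n : ℝ≥0) ≠ 0 := by exact_mod_cast hn.ne'
  refine ⟨fun w g hw h h1 horth => ?_, fun C hC => ?_⟩
  · have hcoe : ((1 / (n : ℝ≥0) : ℝ≥0) : ℝ≥0∞) = (n : ℝ≥0∞)⁻¹ := by
      rw [one_div, ENNReal.coe_inv hn', ENNReal.coe_natCast]
    rw [hcoe]
    -- A weak gradient need not lie in `L²(μ)`; if its norm is infinite the right-hand side is `⊤`,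
    -- as `1 / n` is nonzero.
    by_cases hg : eLpNorm g 2 (gaussianMeasure d) = ⊤
    · rw [hg, ENNReal.top_pow two_ne_zero, ENNReal.mul_top (by simp)]
      exact le_top
    · have hgm : MemLp g 2 (gaussianMeasure d) :=
        ⟨h.locallyIntegrable_grad.aestronglyMeasurable.mono_ac
          gaussianMeasure_absolutelyContinuous, lt_top_iff_ne_top.2 hg⟩
      rw [← ENNReal.mul_le_iff_le_inv (by exact_mod_cast hn.ne') (by simp)]
      exact h.natCast_mul_eLpNorm_sub_one_sq_le hw hgm h1 horth
  -- The extremal function `1 + H_k` with `k = n e₀`: its deviation from `1` has squared norm `1`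
  -- and its gradient has squared norm `n`, which forces `1 ≤ C n`.
  · let k : Fin d → ℕ := Pi.single ⟨0, hd⟩ n
    have hk : ∑ i, k i = n := by simp [k]
    have hk0 : k ≠ 0 := fun h0 => by simp [h0] at hk; omega
    have hmem : MemLp (fun x => 1 + hermiteTensor k x) 2 (gaussianMeasure d) :=
      (memLp_const (1 : ℝ)).add (memLp_hermiteTensor k)
    have key := hC _ _ hmem (hasWeakGradient_one_add_hermiteTensor k) ?_ ?_
    · simp only [add_sub_cancel_left] at key
      rw [eLpNorm_hermiteTensor_sq, eLpNorm_grad_hermiteTensor_sq, hk] at key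
      rw [div_le_iff₀ (by positivity)]
      exact_mod_cast key
    · rw [integral_add (integrable_const 1) ((memLp_hermiteTensor k).integrable (by norm_num)),
        integral_hermiteTensor_of_ne_zero hk0]
      simp
    · intro l hl0 hln
      refine integral_one_add_hermiteTensor_mul ?_ ?_
      · rintro rfl
        simp at hl0
      · rintro rfl
        omega
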